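/- Let $G=(V,E,\ell)$ be a finite undirected graph with $n$ nodes and nonnegative edge lengths, $d_G$ its shortest-path distance (infinite between different components), and $B(v,r)=\{w\in V: d_G(v,w)\le r\}$. Let $\mathcal{D}>0$, let $\tau\ge 2$ be an integer, and let $\mathcal{X}\subseteq V$ be a set of centers such that every $v\in V$ satisfies: (covering) some $x\in\mathcal{X}$ has $d_G(v,x)\le\mathcal{D}$; (packing) at most $\tau$ centers $x\in\mathcal{X}$ have $d_G(v,x)\le 6\mathcal{D}$. Let $0\le\epsilon\le\frac{1}{40\log\tau}$, where $\log$ is the natural logarithm. A pseudo-padded decomposition is computed as follows. 1. Each $x\in\mathcal{X}$ independently draws $Y_x$ from the exponential distribution with parameter $\lambda=2+2\log\tau$ truncated to $[0,1]$, i.e. with density $\frac{\lambda e^{-\lambda y}}{1-e^{-\lambda}}$ on $[0,1]$, and sets $\delta_x=\mathcal{D}\,Y_x$. Optionally the $\delta_x$ are rounded: then $\delta_x\in[0,\mathcal{D}]$ is any value with $|\delta_x-\mathcal{D}\,Y_x|\le \mathcal{D}/n^{b}$, for some $b\ge 1$. 2. Add a virtual source $s$ and, for each $x\in\mathcal{X}$,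 an edge $\{s,x\}$ of length $\mathcal{D}-\delta_x$; call the resulting graph $G_s$. 3. Compute a $(1+\epsilon)$-approximate shortest-path tree $T$ of $G_s$ rooted at $s$: a spanning tree of $G_s$ with $d_T(v,s)\le(1+\epsilon)\,d_{G_s}(v,s)$ for all $v$. The tree may be any such tree, and it may depend arbitrarily on the random outcome. 4. The cluster $K_x$ of $x\in\mathcal{X}$ consists of all $v\in V$ for which $x$ is the last node before $s$ on the path from $v$ to $s$ in $T$. The nonempty sets $K_x$ partition $V$. Then there are absolute constants $c\ge 1$ and $n_0$ such that the following holds for all such data, provided that $n\ge n_0$ and $\tau\le n$ in case the offsets $\delta_x$ are rounded (without rounding, nothing further is required). For every fixed node $u\in V$, with probability at least $\frac12$ (more precisely, on a measurable event of probability at least $\frac12$): if $K_x$ is the cluster that contains $u$, there is a path $P_u=(u=v_1,\dots,v_N=x)$ in $G$ from $u$ to the cluster center $x$, of length at most $2\left(1+\frac{1}{40\log\tau}\right)\mathcal{D}$, such that $B\!\left(v_j,\frac{\mathcal{D}}{c\log\tau}\right)\subseteq K_x$ for every node $v_j$ of $P_u$. -/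

import Mathlib

open scoped NNReal ENNReal

noncomputable section

namespace PseudoPadded

/-- The length of a walk in a graph whose edges carry nonnegative lengths `ℓ`. -/
def walkLength {W : Type*} {H : SimpleGraph W} (ℓ : Sym2 W → ℝ≥0) {a b : W}
    (p : H.Walk a b) : ℝ≥0 :=
  (p.edges.map ℓ).sum

/-- The weighted shortest-path distance; it is `∞` between different components. -/
def wdist {W : Type*} (H : SimpleGraph W) (ℓ : Sym2 W → ℝ≥0) (a b : W) : ℝ≥0∞ :=
  ⨅ p : H.Walk a b, (walkLength ℓ p : ℝ≥0∞)

/-- The (closed) ball of radius `r` around `a` in the weighted distance. -/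
def wball {W : Type*} (H : SimpleGraph W) (ℓ : Sym2 W → ℝ≥0) (a : W) (r : ℝ) : Set W :=
  {b | wdist H ℓ a b ≤ ENNReal.ofReal r}

/-- The exponential distribution with parameter `lam`, truncated to `[0,1]`: the law with density
`lam * exp (-lam * y) / (1 - exp (-lam))` on `[0,1]`. -/
def truncExp (lam : ℝ) : MeasureTheory.Measure ℝ :=
  (MeasureTheory.volume.restrict (Set.Icc 0 1)).withDensity
    fun y => ENNReal.ofReal (lam * Real.exp (-lam * y) / (1 - Real.exp (-lam)))

/-- The graph `G` together with a virtual source `none` that is joined to every center. -/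
def superGraph {V : Type*} (G : SimpleGraph V) (X : Set V) : SimpleGraph (Option V) where
  Adj
    | none, none => False
    | none, some x => x ∈ X
    | some x, none => x ∈ X
    | some a, some b => G.Adj a b
  symm := ⟨by
    rintro (_ | a) (_ | b) h
    · exact h
    · exact h
    · exact h
    · exact G.adj_symm h⟩
  loopless := ⟨by
    rintro (_ | a) h
    · exact h
    · exact G.irrefl h⟩

/-- Edge lengths of `superGraph`: those of `G`, and `w x` for the edge from the source to `x`. -/
def superLength {V : Type*} (ℓ : Sym2 V → ℝ≥0) (w : V → ℝ≥0) : Sym2 (Option V) → ℝ≥0 :=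
  Sym2.lift ⟨fun a b =>
    match a, b with
    | none, none => 0
    | none, some x => w x
    | some x, none => w x
    | some a, some b => ℓ s(a, b), by
    rintro (_ | a) (_ | b)
    · rfl
    · rfl
    · rfl
    · simp only [Sym2.eq_swap]⟩

/-- `T` is a spanning tree of `H` that is a `(1+ε)`-approximate shortest-path tree for the root
`s`. -/
structure IsApproxSPTree {W : Type*} (H : SimpleGraph W) (ℓ : Sym2 W → ℝ≥0) (s : W) (ε : ℝ)
    (T : SimpleGraph W) : Prop where
  le : T ≤ H
  isTree : T.IsTree
  dist_le : ∀ v, wdist T ℓ v s ≤ ENNReal.ofReal (1 + ε) * wdist H ℓ v s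

/-- The cluster of the center `x` that a tree `T` on `V` and the virtual source determines: all
nodes `v` such that `x` is the last node before the source on the tree path from `v`
to the source. -/
def cluster {V : Type*} (T : SimpleGraph (Option V)) (x : V) : Set V :=
  {v | ∃ p : T.Walk (some v) none, p.IsPath ∧ p.penultimate = some x}

/-- A random execution of the clustering algorithm on the weighted graph `(G, ℓ)` with centers `X`,
distance parameter `D`, packing parameter `τ`, approximation error `ε`, rounding error `η`.

The centers draw independent truncated exponential variables `Y x`. The offset `δ ω x` is
`D * Y x ω` up to rounding by at most `η * D`. The source is joined to the center `x` by an
edge of length `D - δ ω x`, and `T ω` is an approximate shortest-path tree from the source in the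
resulting graph (any such tree; it may depend on the outcome `ω` in an arbitrary way). The computed
clusters are the sets `cluster (T ω) x`. -/
structure IsRun {V : Type*} (G : SimpleGraph V) (ℓ : Sym2 V → ℝ≥0) (X : Set V) (D : ℝ) (τ : ℕ)
    (ε η : ℝ) {Ω : Type*} [MeasurableSpace Ω] (P : MeasureTheory.Measure Ω)
    (Y : V → Ω → ℝ) (δ : Ω → V → ℝ) (T : Ω → SimpleGraph (Option V)) : Prop where
  indep : ProbabilityTheory.iIndepFun (fun x : X => Y x) P
  law : ∀ x ∈ X, ProbabilityTheory.HasLaw (Y x) (truncExp (2 + 2 * Real.log τ)) P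
  offset : ∀ᵐ ω ∂P, ∀ x ∈ X, δ ω x ∈ Set.Icc 0 D ∧ |δ ω x - D * Y x ω| ≤ η * D
  tree : ∀ᵐ ω ∂P, IsApproxSPTree (superGraph G X)
    (superLength ℓ fun x => (D - δ ω x).toNNReal) none ε (T ω)

end PseudoPadded

end

/-! Fix `u` and score each center `z` by its shifted distance `d(u,z) + D - δ z`. The distance `F`
from `u` to the source is at most every such score, and `F ≤ 2D` by covering. The tree path of `u`
enters the source through some `x` of score at most `(1+ε)F`. If `v` lies on this path and `b` is
within `ρ` of `v`, then going from `u` to `v` to `b` and on to the center `y` of `b` shows that `y`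
has score at most `(1+ε)²F + (2+ε)ρ` (`exists_cluster_path`). So if padding fails, two distinct
centers are optimal up to `margin * D`. Both lie within `6D` of `u`, where packing leaves at most
`τ` candidates.

In units of `D`, up to rounding, this means that two of at most `τ` independent variables `Y z -
d(u,z)/D` come within `Δ = margin` of the maximum. By near-memorylessness, `Y i` exceeds its rivals
by at most `Δ` with probability at most `1 - exp (-λΔ)` times the probability that `i` wins, plus a
small truncation term. The winning events are disjoint, so the total is at most `(1 - exp (-λΔ)) (1
+ τ/(exp λ - 1))` (`measure_two_near_max_le`), which the constants keep below `1/2`. -/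

namespace PseudoPadded

/-! ### Weighted distances and tree paths. -/

section Walks

variable {W : Type*} {H : SimpleGraph W} {ℓ : Sym2 W → ℝ≥0}

@[simp]
theorem walkLength_nil (a : W) : walkLength ℓ (SimpleGraph.Walk.nil : H.Walk a a) = 0 := by
  simp [walkLength]

@[simp]
theorem walkLength_cons {a b c : W} (h : H.Adj a b) (p : H.Walk b c) :
    walkLength ℓ (SimpleGraph.Walk.cons h p) = ℓ s(a, b) + walkLength ℓ p := by
  simp [walkLength]

theorem wdist_le_walkLength {a b : W} (p : H.Walk a b) : wdist H ℓ a b ≤ walkLength ℓ p :=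
  iInf_le _ p

theorem wdist_triangle (a b c : W) : wdist H ℓ a c ≤ wdist H ℓ a b + wdist H ℓ b c := by
  unfold wdist
  rw [ENNReal.iInf_add]
  refine le_iInf fun p => ?_
  rw [ENNReal.add_iInf]
  refine le_iInf fun q => (iInf_le _ (p.append q)).trans ?_
  simp [walkLength, SimpleGraph.Walk.edges_append]

theorem wdist_comm (a b : W) : wdist H ℓ a b = wdist H ℓ b a := by
  have key : ∀ a b : W, wdist H ℓ a b ≤ wdist H ℓ b a := fun a b =>
    le_iInf fun p => (iInf_le _ p.reverse).trans (by simp [walkLength])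
  exact (key a b).antisymm (key b a)

/-- In an acyclic graph, the length of a path is the distance of its ends. -/
theorem walkLength_eq_wdist {T : SimpleGraph W} (hT : T.IsAcyclic) {a b : W} {p : T.Walk a b}
    (hp : p.IsPath) : (walkLength ℓ p : ℝ≥0∞) = wdist T ℓ a b := by
  classical
  refine le_antisymm (le_iInf fun q => ?_) (wdist_le_walkLength p)
  -- Paths in a forest are unique, and bypassing only deletes edges of nonnegative length.
  have h : p = q.bypass :=
    congrArg Subtype.val ((hT.subsingleton_path a b).elim ⟨p, hp⟩ q.toPath)
  rw [h, ENNReal.coe_le_coe]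
  exact (q.edges_bypass_sublist_edges.map ℓ).sum_le_sum (by simp)

theorem wdist_anti {T : SimpleGraph W} (hT : T ≤ H) (a b : W) : wdist H ℓ a b ≤ wdist T ℓ a b :=
  le_iInf fun p => (iInf_le _ (p.mapLe hT)).trans (by simp [walkLength])

end Walks

/-! ### Paths through the virtual source. -/

section Super

variable {V : Type*} {G : SimpleGraph V} {ℓ : Sym2 V → ℝ≥0} {X : Set V} {w : V → ℝ≥0}

theorem wdist_superGraph_le (a b : V) :
    wdist (superGraph G X) (superLength ℓ w) (some a) (some b) ≤ wdist G ℓ a b := by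
  let φ : G →g superGraph G X := ⟨some, fun h => h⟩
  refine le_iInf fun p => (iInf_le _ (p.map φ)).trans (le_of_eq ?_)
  induction p with
  | nil => simp
  | cons h p ih =>
    simp only [SimpleGraph.Walk.map_cons, walkLength_cons, ENNReal.coe_add]
    rw [ih]
    rfl

theorem wdist_superGraph_source_le {x : V} (hx : x ∈ X) :
    wdist (superGraph G X) (superLength ℓ w) (some x) none ≤ w x := by
  have h : (superGraph G X).Adj (some x) none := hx
  refine (wdist_le_walkLength (SimpleGraph.Walk.cons h .nil)).trans (le_of_eq ?_)
  simp [superLength]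

theorem wdist_superGraph_source_le_add {x : V} (hx : x ∈ X) (u : V) :
    wdist (superGraph G X) (superLength ℓ w) (some u) none ≤ wdist G ℓ u x + w x :=
  (wdist_triangle _ (some x) _).trans
    (add_le_add (wdist_superGraph_le u x) (wdist_superGraph_source_le hx))

/-- A path to the source splits into a path of `G` to a center and an edge to the source. -/
theorem exists_path_to_center {T : SimpleGraph (Option V)} (hT : T ≤ superGraph G X)
    {a b : Option V} (q : T.Walk a b) (hb : b = none) (hq : q.IsPath) (u : V) (hu : a = some u) :
    ∃ x ∈ X, ∃ p : G.Walk u x, p.IsPath ∧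
      walkLength (superLength ℓ w) q = walkLength ℓ p + w x ∧ q.penultimate = some x ∧
      (∀ v ∈ p.support, some v ∈ q.support) ∧
      ∀ v ∈ p.support, ∃ r : G.Walk u v, ∃ q' : T.Walk (some v) b,
        q'.IsPath ∧ q'.penultimate = some x ∧
          walkLength ℓ r + walkLength (superLength ℓ w) q' ≤
            walkLength (superLength ℓ w) q := by
  induction q generalizing u with
  | nil => simp [hb] at hu
  | @cons a b c h q ih =>
    subst hb hu
    have hqp := (SimpleGraph.Walk.cons_isPath_iff h q).1 hq
    rcases b with _ | b
    -- A path ending at the source cannot have visited it earlier, so this edge is the last one.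
    · have hnil : q = .nil := (SimpleGraph.Walk.isPath_iff_nil.1 hqp.1).eq_nil
      subst hnil
      refine ⟨u, hT h, .nil, .nil, ?_, ?_, ?_, ?_⟩
      · simp [superLength]
      · simp
      · simp
      · intro v hv
        obtain rfl : v = u := by simpa using hv
        exact ⟨.nil, .cons h .nil, hq, by simp, by simp⟩
    · have hadj : G.Adj u b := hT h
      obtain ⟨x, hx, p, hp, hlen, hpen, hsupp, hsuff⟩ := ih rfl hqp.1 b rfl
      have hpen' : (SimpleGraph.Walk.cons h q).penultimate = some x := by
        rw [SimpleGraph.Walk.penultimate_cons_of_not_nil _ _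
          (SimpleGraph.Walk.not_nil_of_ne (by simp)), hpen]
      refine ⟨x, hx, .cons hadj p, ?_, ?_, hpen', ?_, ?_⟩
      · rw [SimpleGraph.Walk.cons_isPath_iff]
        exact ⟨hp, fun hmem => hqp.2 (hsupp u hmem)⟩
      · rw [walkLength_cons, walkLength_cons, hlen, add_assoc]
        rfl
      · intro v hv
        rw [SimpleGraph.Walk.support_cons, List.mem_cons] at hv ⊢
        exact hv.imp (congrArg some) (hsupp v)
      · intro v hv
        rw [SimpleGraph.Walk.support_cons, List.mem_cons] at hv
        rcases hv with rfl | hv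
        · exact ⟨.nil, .cons h q, hq, hpen', by simp⟩
        · obtain ⟨r, q', h1, h2, h3⟩ := hsuff v hv
          refine ⟨.cons hadj r, q', h1, h2, ?_⟩
          rw [walkLength_cons, walkLength_cons, add_assoc]
          exact add_le_add le_rfl h3

/-- Every node lies in the cluster of a center `x` and is joined to `x` by a path, such that the
center of every node close to the path almost minimizes the shifted distance from `u`. -/
theorem exists_cluster_path {T : SimpleGraph (Option V)} {ε : ℝ} (hε : 0 ≤ ε)
    (hT : IsApproxSPTree (superGraph G X) (superLength ℓ w) none ε T) (u : V) :
    ∃ x ∈ X, u ∈ cluster T x ∧ ∃ p : G.Walk u x, p.IsPath ∧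
      (walkLength ℓ p : ℝ≥0∞) + w x ≤ ENNReal.ofReal (1 + ε) *
        wdist (superGraph G X) (superLength ℓ w) (some u) none ∧
      ∀ v ∈ p.support, ∀ b, ∃ y ∈ X, b ∈ cluster T y ∧
        wdist G ℓ u y + w y ≤ ENNReal.ofReal (1 + ε) * (ENNReal.ofReal (1 + ε) *
          wdist (superGraph G X) (superLength ℓ w) (some u) none) +
          (1 + ENNReal.ofReal (1 + ε)) * wdist G ℓ v b := by
  set c := ENNReal.ofReal (1 + ε) with hc
  have hc1 : 1 ≤ c := by rw [hc, ENNReal.one_le_ofReal]; linarith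
  obtain ⟨q, hq, -⟩ := hT.isTree.existsUnique_path (some u) none
  obtain ⟨x, hx, p, hp, hlen, hpen, -, hsuff⟩ :=
    exists_path_to_center (ℓ := ℓ) (w := w) hT.le q rfl hq u rfl
  have hq_le := (walkLength_eq_wdist (ℓ := superLength ℓ w) hT.isTree.isAcyclic hq).le.trans
    (hT.dist_le (some u))
  refine ⟨x, hx, ⟨q, hq, hpen⟩, p, hp, ?_, fun v hv b => ?_⟩
  · rw [← ENNReal.coe_add, ← hlen]
    exact hq_le
  obtain ⟨r, q', -, -, hr⟩ := hsuff v hv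
  obtain ⟨s, hs, -⟩ := hT.isTree.existsUnique_path (some b) none
  obtain ⟨y, hy, t, -, htlen, htpen, -, -⟩ :=
    exists_path_to_center (ℓ := ℓ) (w := w) hT.le s rfl hs b rfl
  refine ⟨y, hy, ⟨s, hs, htpen⟩, ?_⟩
  -- The tree path of `b` competes with the detour through `v` along the rest `q'` of the tree path
  -- of `u`.
  have h1 : wdist G ℓ b y + w y ≤ c * (wdist G ℓ v b + walkLength (superLength ℓ w) q') :=
    calc wdist G ℓ b y + w y ≤ (walkLength (superLength ℓ w) s : ℝ≥0∞) := by
          rw [htlen, ENNReal.coe_add]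
          exact add_le_add (wdist_le_walkLength t) le_rfl
      _ ≤ c * wdist (superGraph G X) (superLength ℓ w) (some b) none :=
          (walkLength_eq_wdist hT.isTree.isAcyclic hs).le.trans (hT.dist_le (some b))
      _ ≤ _ := by
          gcongr
          refine (wdist_triangle _ (some v) _).trans (add_le_add ?_ ?_)
          · rw [wdist_comm v b]
            exact wdist_superGraph_le b v
          · exact (wdist_anti hT.le _ _).trans (wdist_le_walkLength q')
  calc wdist G ℓ u y + w y
      ≤ (walkLength ℓ r + wdist G ℓ v b + wdist G ℓ b y) + w y := by
        gcongr
        refine (wdist_triangle u v y).trans ?_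
        rw [add_assoc]
        exact add_le_add (wdist_le_walkLength r) (wdist_triangle v b y)
    _ ≤ (walkLength ℓ r + wdist G ℓ v b) +
          c * (wdist G ℓ v b + walkLength (superLength ℓ w) q') := by
        rw [add_assoc]
        exact add_le_add le_rfl h1
    -- Inflating `r` by `c ≥ 1` lets `r` and `q'` recombine into the tree path of `u`, at the cost
    -- of a second factor `c`.
    _ ≤ (c * walkLength ℓ r + wdist G ℓ v b) +
          c * (wdist G ℓ v b + walkLength (superLength ℓ w) q') := by
        gcongr
        exact le_mul_of_one_le_left' hc1
    _ = c * ((walkLength ℓ r + walkLength (superLength ℓ w) q' : ℝ≥0) : ℝ≥0∞) +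
          (1 + c) * wdist G ℓ v b := by
        rw [ENNReal.coe_add]; ring
    _ ≤ _ := by
        gcongr
        exact (ENNReal.coe_le_coe.2 hr).trans hq_le

end Super

end PseudoPadded

namespace PseudoPadded

/-! ### Truncated exponential variables near their maximum. -/

section Probability

open MeasureTheory ProbabilityTheory

theorem truncExp_absolutelyContinuous (lam : ℝ) : truncExp lam ≪ volume :=
  (withDensity_absolutelyContinuous _ _).trans Measure.restrict_le_self.absolutelyContinuous

instance (lam : ℝ) : NullSingletonClass (truncExp lam) :=
  ⟨fun x => truncExp_absolutelyContinuous lam (measure_singleton x)⟩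

theorem truncExp_Icc {lam a b : ℝ} (hlam : 0 < lam) (ha : 0 ≤ a) (hab : a ≤ b) (hb : b ≤ 1) :
    truncExp lam (Set.Icc a b) =
      ENNReal.ofReal ((Real.exp (-lam * a) - Real.exp (-lam * b)) / (1 - Real.exp (-lam))) := by
  have hden : 0 < 1 - Real.exp (-lam) := by
    rw [sub_pos, Real.exp_lt_one_iff]; linarith
  rw [truncExp, withDensity_apply _ measurableSet_Icc, Measure.restrict_restrict measurableSet_Icc,
    Set.inter_eq_left.2 (Set.Icc_subset_Icc ha hb), ← ofReal_integral_eq_lintegral_ofReal]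
  · rw [integral_Icc_eq_integral_Ioc, ← intervalIntegral.integral_of_le hab]
    congr 1
    rw [intervalIntegral.integral_eq_sub_of_hasDerivAt
      (f := fun y => -Real.exp (-lam * y) / (1 - Real.exp (-lam)))]
    · ring
    · intro x _
      have h := (((hasDerivAt_id x).const_mul (-lam)).exp.neg).div_const (1 - Real.exp (-lam))
      refine HasDerivAt.congr_deriv h ?_
      simp only [id]
      ring
    · exact (by fun_prop : Continuous _).intervalIntegrable _ _
  · exact (by fun_prop : Continuous _).continuousOn.integrableOn_Icc
  · exact Filter.Eventually.of_forall fun y =>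
      div_nonneg (mul_nonneg hlam.le (Real.exp_pos _).le) hden.le

theorem truncExp_inter_Icc (lam : ℝ) (s : Set ℝ) :
    truncExp lam (s ∩ Set.Icc 0 1) = truncExp lam s := by
  have h : truncExp lam (Set.Icc 0 1)ᶜ = 0 := by
    rw [truncExp, withDensity_apply _ measurableSet_Icc.compl,
      Measure.restrict_restrict measurableSet_Icc.compl]
    simp
  exact measure_inter_conull h

/-- The truncated exponential distribution is almost memoryless. -/
theorem truncExp_Icc_le {lam Δ : ℝ} (hlam : 0 < lam) (hΔ : 0 ≤ Δ) (r : ℝ) :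
    truncExp lam (Set.Icc r (r + Δ)) ≤ ENNReal.ofReal (1 - Real.exp (-lam * Δ)) *
      (truncExp lam (Set.Ioi r) + ENNReal.ofReal (1 / (Real.exp lam - 1))) := by
  have hexp : Real.exp (-lam) < 1 := by rw [Real.exp_lt_one_iff]; linarith
  have hexp' : 1 < Real.exp lam := by rw [Real.one_lt_exp_iff]; exact hlam
  have hC : 0 ≤ 1 - Real.exp (-lam * Δ) := by
    rw [sub_nonneg, Real.exp_le_one_iff]; nlinarith
  rcases lt_or_ge 1 r with hr | hr
  · have h : Set.Icc r (r + Δ) ∩ Set.Icc 0 1 = ∅ :=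
      Set.eq_empty_of_forall_notMem fun y hy => by linarith [hy.1.1, hy.2.2]
    rw [← truncExp_inter_Icc, h, measure_empty]
    exact zero_le
  · set s := max r 0 with hs
    have hs0 : 0 ≤ s := le_max_right _ _
    have hs1 : s ≤ 1 := max_le hr zero_le_one
    have hsb : s ≤ min (s + Δ) 1 := le_min (by linarith) hs1
    calc truncExp lam (Set.Icc r (r + Δ))
        = truncExp lam (Set.Icc r (r + Δ) ∩ Set.Icc 0 1) := (truncExp_inter_Icc _ _).symm
      _ ≤ truncExp lam (Set.Icc s (min (s + Δ) 1)) := by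
          refine measure_mono ?_
          rintro y ⟨⟨h1, h2⟩, h3, h4⟩
          exact ⟨max_le h1 h3, le_min (by linarith [le_max_left r 0]) h4⟩
      _ ≤ ENNReal.ofReal (1 - Real.exp (-lam * Δ)) *
          (truncExp lam (Set.Icc s 1) + ENNReal.ofReal (1 / (Real.exp lam - 1))) := by
          rw [truncExp_Icc hlam hs0 hsb (min_le_right _ _), truncExp_Icc hlam hs0 hs1 le_rfl,
            ← ENNReal.ofReal_add, ← ENNReal.ofReal_mul hC]
          · refine ENNReal.ofReal_le_ofReal ?_
            -- The additive term is exactly the mass `exp (-λ) / (1 - exp (-λ))` beyond `1` lost by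
            -- truncation; restoring it gives the pure exponential tail.
            have h1 : 1 / (Real.exp lam - 1) = Real.exp (-lam) / (1 - Real.exp (-lam)) := by
              rw [Real.exp_neg]
              have : Real.exp lam - 1 ≠ 0 := by linarith
              have : 1 - (Real.exp lam)⁻¹ ≠ 0 := by
                rw [← Real.exp_neg]; linarith
              field_simp
            have h2 : Real.exp (-lam * s) * Real.exp (-lam * Δ) ≤
                Real.exp (-lam * min (s + Δ) 1) := by
              rw [← Real.exp_add, Real.exp_le_exp]
              nlinarith [min_le_left (s + Δ) 1]
            rw [h1, ← add_div, ← mul_div_assoc]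
            refine div_le_div_of_nonneg_right ?_ (by linarith)
            rw [mul_one]
            nlinarith
          · refine div_nonneg ?_ (by linarith)
            rw [sub_nonneg, Real.exp_le_exp]; nlinarith
          · exact div_nonneg zero_le_one (by linarith)
      _ ≤ _ := by
          refine mul_le_mul_right (add_le_add_left ?_ _) _
          rw [← measure_congr (Ioc_ae_eq_Icc (μ := truncExp lam))]
          exact measure_mono fun y hy => lt_of_le_of_lt (le_max_left _ _) hy.1

variable {Ω : Type*} [MeasurableSpace Ω] {P : Measure Ω} [IsProbabilityMeasure P]

/-- The bound of `truncExp_Icc_le` for a random, independent left end point. -/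
theorem measure_mem_Icc_le {lam Δ : ℝ} (hlam : 0 < lam) (hΔ : 0 ≤ Δ) {U Z : Ω → ℝ}
    (hU : HasLaw U (truncExp lam) P) (hZ : AEMeasurable Z P) (hind : IndepFun U Z P) :
    P {ω | Z ω ≤ U ω ∧ U ω ≤ Z ω + Δ} ≤ ENNReal.ofReal (1 - Real.exp (-lam * Δ)) *
      (P {ω | Z ω < U ω} + ENNReal.ofReal (1 / (Real.exp lam - 1))) := by
  have hpair := hU.aemeasurable.prodMk hZ
  have hmap := (indepFun_iff_map_prod_eq_prod_map_map hU.aemeasurable hZ).1 hind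
  have : IsProbabilityMeasure (P.map U) := Measure.isProbabilityMeasure_map hU.aemeasurable
  have : IsProbabilityMeasure (P.map Z) := Measure.isProbabilityMeasure_map hZ
  have hA : MeasurableSet {q : ℝ × ℝ | q.2 ≤ q.1 ∧ q.1 ≤ q.2 + Δ} :=
    (measurableSet_le measurable_snd measurable_fst).inter
      (measurableSet_le measurable_fst (measurable_snd.add_const Δ))
  have hB : MeasurableSet {q : ℝ × ℝ | q.2 < q.1} :=
    measurableSet_lt measurable_snd measurable_fst
  -- Independence makes the joint law a product, so Fubini reduces to a fixed left end point.
  have e1 : P {ω | Z ω ≤ U ω ∧ U ω ≤ Z ω + Δ} =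
      ∫⁻ z, truncExp lam (Set.Icc z (z + Δ)) ∂(P.map Z) := by
    rw [← hU.map_eq]
    have h := Measure.map_apply_of_aemeasurable hpair hA
    rw [hmap, Measure.prod_apply_symm hA] at h
    exact h.symm
  have e2 : P {ω | Z ω < U ω} = ∫⁻ z, truncExp lam (Set.Ioi z) ∂(P.map Z) := by
    rw [← hU.map_eq]
    have h := Measure.map_apply_of_aemeasurable hpair hB
    rw [hmap, Measure.prod_apply_symm hB] at h
    exact h.symm
  rw [e1, e2]
  refine (lintegral_mono fun z => truncExp_Icc_le hlam hΔ z).trans ?_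
  rw [lintegral_const_mul' _ _ ENNReal.ofReal_ne_top, lintegral_add_right _ measurable_const]
  simp

/-- Among independent shifted truncated exponential variables, two of them rarely come within `Δ`
of the maximum. -/
theorem measure_two_near_max_le {ι : Type*} [Fintype ι] {lam Δ : ℝ} (hlam : 0 < lam) (hΔ : 0 ≤ Δ)
    {Y : ι → Ω → ℝ} (hind : iIndepFun Y P) (hY : ∀ i, HasLaw (Y i) (truncExp lam) P)
    (a : ι → ℝ) :
    P {ω | ∃ i j, i ≠ j ∧ ∀ k, Y k ω - a k ≤ Y i ω - a i + Δ ∧ Y k ω - a k ≤ Y j ω - a j + Δ} ≤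
      ENNReal.ofReal (1 - Real.exp (-lam * Δ)) *
        (1 + Fintype.card ι * ENNReal.ofReal (1 / (Real.exp lam - 1))) := by
  classical
  -- `E i` allows ties, so that the sets cover the bad event; `M i` is strict, so that these sets
  -- are disjoint.
  let E : ι → Set Ω := fun i => {ω | (∀ j, Y j ω - a j ≤ Y i ω - a i) ∧
    ∃ j, j ≠ i ∧ Y i ω - a i ≤ Y j ω - a j + Δ}
  let M : ι → Set Ω := fun i => {ω | ∀ j, j ≠ i → Y j ω - a j < Y i ω - a i}
  have hsub : {ω | ∃ i j, i ≠ j ∧ ∀ k, Y k ω - a k ≤ Y i ω - a i + Δ ∧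
      Y k ω - a k ≤ Y j ω - a j + Δ} ⊆ ⋃ i, E i := by
    rintro ω ⟨i, j, hij, h⟩
    have : Nonempty ι := ⟨i⟩
    obtain ⟨m, hm⟩ := Finite.exists_max fun k => Y k ω - a k
    refine Set.mem_iUnion.2 ⟨m, hm, ?_⟩
    rcases eq_or_ne i m with rfl | him
    · exact ⟨j, hij.symm, (h i).2⟩
    · exact ⟨i, him, (h m).1⟩
  have hE : ∀ i, P (E i) ≤ ENNReal.ofReal (1 - Real.exp (-lam * Δ)) *
      (P (M i) + ENNReal.ofReal (1 / (Real.exp lam - 1))) := by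
    intro i
    -- Without rivals there is no maximum to compare with, and `E i` is empty.
    rcases (Finset.univ.erase i).eq_empty_or_nonempty with he | hne
    · have : E i = ∅ := by
        refine Set.eq_empty_of_forall_notMem ?_
        rintro ω ⟨_, j, hj, _⟩
        have : j ∈ Finset.univ.erase i := by simp [hj]
        simp [he] at this
      simp [this]
    -- The value that `Y i` must reach in order to match its best rival.
    · let g : (↥(Finset.univ.erase i) → ℝ) → ℝ := fun y =>
        (Finset.univ.erase i).attach.sup' (by simpa using hne) (fun j => y j - a j) + a i
      have hg : Measurable g := by
        refine Measurable.add_const ?_ _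
        have := Finset.measurable_sup' (s := (Finset.univ.erase i).attach) (by simpa using hne)
          (f := fun j (y : ↥(Finset.univ.erase i) → ℝ) => y j - a j)
          (fun j _ => (measurable_pi_apply j).sub_const _)
        convert this using 1
        ext y; simp [Finset.sup'_apply]
      let Z : Ω → ℝ := fun ω => g fun j => Y j ω
      have hZ : AEMeasurable Z P :=
        hg.comp_aemeasurable (aemeasurable_pi_lambda _ fun j => (hY j).aemeasurable)
      have hI : IndepFun (Y i) Z P := by
        have h := hind.indepFun_finset₀ {i} (Finset.univ.erase i) (by simp)
          fun j => (hY j).aemeasurable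
        exact h.comp (φ := fun y : ↥({i} : Finset ι) → ℝ => y ⟨i, by simp⟩) (ψ := g)
          (measurable_pi_apply _) hg
      have hb := measure_mem_Icc_le hlam hΔ (hY i) hZ hI
      have e1 : E i ⊆ {ω | Z ω ≤ Y i ω ∧ Y i ω ≤ Z ω + Δ} := by
        rintro ω ⟨h1, j, hj, h2⟩
        constructor
        · have : (Finset.univ.erase i).attach.sup' (by simpa using hne)
              (fun j => Y j ω - a j) ≤ Y i ω - a i :=
            Finset.sup'_le _ _ fun k _ => h1 k
          simp only [Z, g]; linarith
        · have := Finset.le_sup' (s := (Finset.univ.erase i).attach)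
              (fun j => Y j ω - a j) (Finset.mem_attach _ ⟨j, by simp [hj]⟩)
          simp only [Z, g]; linarith
      have e2 : {ω | Z ω < Y i ω} ⊆ M i := by
        intro ω hω j hj
        have := Finset.le_sup' (s := (Finset.univ.erase i).attach)
              (fun j => Y j ω - a j) (Finset.mem_attach _ ⟨j, by simp [hj]⟩)
        simp only [Z, g, Set.mem_ofPred_eq] at hω; linarith
      refine (measure_mono e1).trans (hb.trans ?_)
      gcongr
  have hM : ∑ i, P (M i) ≤ 1 := by
    rw [← measure_univ (μ := P)]
    refine sum_measure_le_measure_univ (fun i _ => ?_) ?_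
    · have : M i = ⋂ j, {ω | j ≠ i → Y j ω - a j < Y i ω - a i} := by
        ext; simp [M]
      rw [this]
      refine NullMeasurableSet.iInter fun j => ?_
      by_cases hj : j = i
      · simp [hj]
      · simp only [ne_eq, hj, not_false_eq_true, forall_const]
        exact nullMeasurableSet_lt ((hY j).aemeasurable.sub_const _)
          ((hY i).aemeasurable.sub_const _)
    · intro i _ j _ hij
      refine Disjoint.aedisjoint (Set.disjoint_left.2 fun ω h1 h2 => ?_)
      exact lt_asymm (h1 j hij.symm) (h2 i hij)
  calc _ ≤ ∑ i, P (E i) := (measure_mono hsub).trans (measure_iUnion_fintype_le _ _)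
    _ ≤ ∑ i, ENNReal.ofReal (1 - Real.exp (-lam * Δ)) *
      (P (M i) + ENNReal.ofReal (1 / (Real.exp lam - 1))) := Finset.sum_le_sum fun i _ => hE i
    _ = ENNReal.ofReal (1 - Real.exp (-lam * Δ)) *
        (∑ i, P (M i) + Fintype.card ι * ENNReal.ofReal (1 / (Real.exp lam - 1))) := by
      rw [← Finset.mul_sum, Finset.sum_add_distrib]
      simp
    _ ≤ _ := by gcongr

end Probability

end PseudoPadded

/-! ### Numerical constants. -/

namespace PseudoPadded

theorem one_sub_exp_neg_le {x : ℝ} (hx : x ≤ 11 / 20) : 1 - Real.exp (-x) ≤ 11 / 25 := by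
  have h1 : (189 / 200 : ℝ) ≤ Real.exp (-(11 / 200)) := by
    linarith [Real.add_one_le_exp (-(11 / 200 : ℝ))]
  -- `1 + t ≤ exp t` is too weak at `-11/20`, but suffices after splitting into ten factors.
  have h2 : Real.exp (-(11 / 200 : ℝ)) ^ 10 = Real.exp (-(11 / 20)) := by
    rw [← Real.exp_nat_mul]; norm_num
  have h3 : (189 / 200 : ℝ) ^ 10 ≤ Real.exp (-(11 / 20)) := by
    rw [← h2]; gcongr
  have h4 : Real.exp (-(11 / 20)) ≤ Real.exp (-x) := Real.exp_le_exp.2 (by linarith)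
  norm_num at h3
  linarith

/-- The choice of `λ` makes `exp λ = e²τ²`, so the truncation errors of `τ` centers add up to at
most `τ/(7τ² - 1)`, which is largest at `τ = 2`. -/
theorem mul_one_div_exp_sub_one_le {τ : ℝ} (hτ : 2 ≤ τ) :
    τ * (1 / (Real.exp (2 + 2 * Real.log τ) - 1)) ≤ 2 / 27 := by
  have h1 : Real.exp (2 + 2 * Real.log τ) = Real.exp 1 ^ 2 * τ ^ 2 := by
    rw [Real.exp_add, two_mul (Real.log τ), Real.exp_add, Real.exp_log (by linarith),
      ← Real.exp_nat_mul]
    norm_num [sq]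
  have h2 : (7 : ℝ) ≤ Real.exp 1 ^ 2 := by nlinarith [Real.exp_one_gt_d9]
  have h3 : 7 * τ ^ 2 ≤ Real.exp 1 ^ 2 * τ ^ 2 := by gcongr
  rw [h1, mul_one_div, div_le_div_iff₀ (by nlinarith) (by norm_num)]
  nlinarith

/-- The total margin by which a competing center may fail to be optimal, in units of `D`. -/
noncomputable def margin (τ : ℕ) (ε η : ℝ) : ℝ :=
  4 * ε + 2 * ε ^ 2 + (2 + ε) / (1000 * Real.log τ) + 2 * η

theorem log_ge_of_two_le {τ : ℕ} (hτ : 2 ≤ τ) : 69 / 100 ≤ Real.log τ := by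
  have h : Real.log 2 ≤ Real.log τ := Real.log_le_log (by norm_num) (by exact_mod_cast hτ)
  linarith [Real.log_two_gt_d9]

theorem le_one_div_of_le_one_div_log {τ : ℕ} {ε : ℝ} (hτ : 2 ≤ τ) (hε : ε ≤ 1 / (40 * Real.log τ)) : ε ≤ 1 / 27 := by
  have hL := log_ge_of_two_le hτ
  refine hε.trans (one_div_le_one_div_of_le (by norm_num) (by linarith))

theorem lam_mul_margin_le {τ : ℕ} {ε η : ℝ} (hτ : 2 ≤ τ) (hε0 : 0 ≤ ε)
    (hε : ε ≤ 1 / (40 * Real.log τ)) (hη : η * Real.log τ ≤ 1 / 2000) :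
    (2 + 2 * Real.log τ) * margin τ ε η ≤ 11 / 20 := by
  have hL := log_ge_of_two_le hτ
  have hε1 := le_one_div_of_le_one_div_log hτ hε
  set L := Real.log τ
  have hεL : ε * L ≤ 1 / 40 := by
    rw [le_div_iff₀ (by linarith)] at hε; linarith
  -- The main term `4εL` is at most `1/10`; the rest fits into `1/200`.
  have hK : margin τ ε η * L ≤ 21 / 200 := by
    have : margin τ ε η * L = (4 + 2 * ε) * (ε * L) + (2 + ε) / 1000 + 2 * (η * L) := by
      have hL0 : L ≠ 0 := by linarith
      change (4 * ε + 2 * ε ^ 2 + (2 + ε) / (1000 * L) + 2 * η) * L = _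
      field_simp
    rw [this]
    nlinarith
  have : (2 + 2 * L) * margin τ ε η * L ≤ 11 / 20 * L := by
    have := mul_le_mul_of_nonneg_left hK (by linarith : 0 ≤ 2 + 2 * L)
    linarith
  exact le_of_mul_le_mul_right this (by linarith)

theorem rounding_le {n τ : ℕ} {b : ℝ} (hn : 10 ^ 9 ≤ n) (hτ : 2 ≤ τ) (hτn : τ ≤ n) (hb : 1 ≤ b) :
    1 / (n : ℝ) ^ b * Real.log τ ≤ 1 / 2000 := by
  have hn' : (10 ^ 9 : ℝ) ≤ n := by exact_mod_cast hn
  have hn0 : (0 : ℝ) < n := by linarith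
  have h1 : (n : ℝ) ≤ (n : ℝ) ^ b := Real.self_le_rpow_of_one_le (by linarith) hb
  have h2 : Real.log τ ≤ Real.log n :=
    Real.log_le_log (by positivity) (by exact_mod_cast hτn)
  have h3 : Real.log n ≤ 2 * √n := by
    rw [← Real.sq_sqrt hn0.le, Real.log_pow, Real.sq_sqrt hn0.le]
    have := Real.log_le_self (Real.sqrt_nonneg (n : ℝ))
    push_cast; linarith
  have h4 : (4000 : ℝ) ≤ √n := Real.le_sqrt_of_sq_le (by linarith)
  have h5 : √(n : ℝ) * √n = n := Real.mul_self_sqrt hn0.le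
  rw [one_div_mul_eq_div, div_le_iff₀ (by positivity)]
  nlinarith

/-! ### From a unique near-optimal center to padding. -/

open MeasureTheory ProbabilityTheory

/-- With probability at least `1/2`, at most one center is optimal up to the margin. -/
theorem measure_margin_le_half {Ω : Type*} [MeasurableSpace Ω] {P : Measure Ω}
    [IsProbabilityMeasure P] {ι : Type*} [Fintype ι] {τ : ℕ} {ε η : ℝ} (hτ : 2 ≤ τ) (hε0 : 0 ≤ ε)
    (hε : ε ≤ 1 / (40 * Real.log τ)) (hη0 : 0 ≤ η) (hη : η * Real.log τ ≤ 1 / 2000)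
    (hι : Fintype.card ι ≤ τ) {Y : ι → Ω → ℝ} (hind : iIndepFun Y P)
    (hY : ∀ i, HasLaw (Y i) (truncExp (2 + 2 * Real.log τ)) P) (a : ι → ℝ) :
    P {ω | ∃ i j, i ≠ j ∧ ∀ k, Y k ω - a k ≤ Y i ω - a i + margin τ ε η ∧
      Y k ω - a k ≤ Y j ω - a j + margin τ ε η} ≤ 1 / 2 := by
  have hL := log_ge_of_two_le hτ
  have hlam : 0 < 2 + 2 * Real.log τ := by linarith
  have hm : 0 ≤ margin τ ε η := by unfold margin; positivity
  refine (measure_two_near_max_le hlam hm hind hY a).trans ?_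
  have h1 := one_sub_exp_neg_le (lam_mul_margin_le hτ hε0 hε hη)
  rw [← neg_mul] at h1
  have hpos : 0 ≤ 1 / (Real.exp (2 + 2 * Real.log τ) - 1) :=
    one_div_nonneg.2 (by linarith [Real.add_one_le_exp (2 + 2 * Real.log τ)])
  have h2 : (Fintype.card ι : ℝ) * (1 / (Real.exp (2 + 2 * Real.log τ) - 1)) ≤ 2 / 27 :=
    (mul_le_mul_of_nonneg_right (by exact_mod_cast hι) hpos).trans
      (mul_one_div_exp_sub_one_le (by exact_mod_cast hτ))
  have e : (1 + Fintype.card ι * ENNReal.ofReal (1 / (Real.exp (2 + 2 * Real.log τ) - 1))) =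
      ENNReal.ofReal (1 + Fintype.card ι * (1 / (Real.exp (2 + 2 * Real.log τ) - 1))) := by
    rw [ENNReal.ofReal_add zero_le_one (by positivity), ENNReal.ofReal_mul (by positivity),
      ENNReal.ofReal_one, ENNReal.ofReal_natCast]
  rw [e]
  calc _ ≤ ENNReal.ofReal (11 / 25) * ENNReal.ofReal (1 + 2 / 27) := by gcongr
    _ = ENNReal.ofReal (11 / 25 * (1 + 2 / 27)) := (ENNReal.ofReal_mul (by norm_num)).symm
    _ ≤ ENNReal.ofReal (1 / 2) := ENNReal.ofReal_le_ofReal (by norm_num)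
    _ = 1 / 2 := by rw [ENNReal.ofReal_div_of_pos two_pos]; simp

/-- If `u` has only one center that is optimal up to the margin, then its cluster contains the
neighborhood of a short path to the cluster center. -/
theorem exists_padded_path {V : Type*} {G : SimpleGraph V} {ℓ : Sym2 V → ℝ≥0} {X : Set V}
    {D : ℝ} {τ : ℕ} {ε η : ℝ} (hD : 0 < D) (hτ : 2 ≤ τ) (hε0 : 0 ≤ ε)
    (hε : ε ≤ 1 / (40 * Real.log τ)) {δ y : V → ℝ} {T : SimpleGraph (Option V)}
    (hδ : ∀ x ∈ X, δ x ∈ Set.Icc 0 D ∧ |δ x - D * y x| ≤ η * D)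
    (hT : IsApproxSPTree (superGraph G X)
      (superLength ℓ fun x => (D - δ x).toNNReal) none ε T) {u : V}
    (hcov : ∃ x ∈ X, wdist G ℓ u x ≤ ENNReal.ofReal D)
    (hgood : ¬ ∃ i j : {x | x ∈ X ∧ wdist G ℓ u x ≤ ENNReal.ofReal (6 * D)}, i ≠ j ∧
      ∀ k : {x | x ∈ X ∧ wdist G ℓ u x ≤ ENNReal.ofReal (6 * D)},
        y k - (wdist G ℓ u k).toReal / D ≤ y i - (wdist G ℓ u i).toReal / D + margin τ ε η ∧
        y k - (wdist G ℓ u k).toReal / D ≤ y j - (wdist G ℓ u j).toReal / D + margin τ ε η) :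
    ∃ x ∈ X, u ∈ cluster T x ∧ ∃ p : G.Walk u x, p.IsPath ∧
      (walkLength ℓ p : ℝ) ≤ 2 * (1 + 1 / (40 * Real.log τ)) * D ∧
      ∀ v ∈ p.support, wball G ℓ v (D / (1000 * Real.log τ)) ⊆ cluster T x := by
  have hL := log_ge_of_two_le hτ
  have hε1 := le_one_div_of_le_one_div_log hτ hε
  set ρ := D / (1000 * Real.log τ) with hρ
  have hρ0 : 0 ≤ ρ := by positivity
  have hρD : ρ ≤ D := div_le_self hD.le (by linarith)
  have hρm : (2 + ε) / (1000 * Real.log τ) * D = (2 + ε) * ρ := by rw [hρ]; ring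
  obtain ⟨F, hF, hF0, hF2, hFz⟩ : ∃ F : ℝ,
      wdist (superGraph G X) (superLength ℓ fun x => (D - δ x).toNNReal) (some u) none =
        ENNReal.ofReal F ∧ 0 ≤ F ∧ F ≤ 2 * D ∧
      ∀ z ∈ X, wdist G ℓ u z ≠ ⊤ → F ≤ (wdist G ℓ u z).toReal + (D - δ z) := by
    set W := wdist (superGraph G X) (superLength ℓ fun x => (D - δ x).toNNReal) (some u) none
    have hW : ∀ z ∈ X, wdist G ℓ u z ≠ ⊤ →
        W ≤ ENNReal.ofReal ((wdist G ℓ u z).toReal + (D - δ z)) := by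
      intro z hz htop
      have h := wdist_superGraph_source_le_add (G := G) (ℓ := ℓ)
        (w := fun x => (D - δ x).toNNReal) hz u
      rwa [ENNReal.ofReal_add ENNReal.toReal_nonneg (by linarith [(hδ z hz).1.2]),
        ENNReal.ofReal_toReal htop]
    obtain ⟨x, hx, hxD⟩ := hcov
    have htop := ne_top_of_le_ne_top ENNReal.ofReal_ne_top hxD
    have hWtop : W ≠ ⊤ := ne_top_of_le_ne_top ENNReal.ofReal_ne_top (hW x hx htop)
    have hle : ∀ z ∈ X, wdist G ℓ u z ≠ ⊤ → W.toReal ≤ (wdist G ℓ u z).toReal + (D - δ z) :=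
      fun z hz hzt => ENNReal.toReal_le_of_le_ofReal
        (by linarith [(hδ z hz).1.2, ENNReal.toReal_nonneg (a := wdist G ℓ u z)]) (hW z hz hzt)
    refine ⟨W.toReal, (ENNReal.ofReal_toReal hWtop).symm, ENNReal.toReal_nonneg, ?_, hle⟩
    linarith [hle x hx htop, (hδ x hx).1.1, ENNReal.toReal_le_of_le_ofReal hD.le hxD]
  /- Centers with almost optimal shifted distance are close, and optimal up to the margin. -/
  have hopt : ∀ z ∈ X, wdist G ℓ u z + ((D - δ z).toNNReal : ℝ≥0∞) ≤
      ENNReal.ofReal ((1 + ε) * ((1 + ε) * F) + (2 + ε) * ρ) →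
      ∃ hz : z ∈ {x | x ∈ X ∧ wdist G ℓ u x ≤ ENNReal.ofReal (6 * D)},
        ∀ k : {x | x ∈ X ∧ wdist G ℓ u x ≤ ENNReal.ofReal (6 * D)},
          y k - (wdist G ℓ u k).toReal / D ≤ y z - (wdist G ℓ u z).toReal / D + margin τ ε η := by
    intro z hz h
    -- The excess `(2ε + ε²)F` is bounded through `F ≤ 2D`; this is the origin of `4ε + 2ε²` in
    -- `margin`.
    have hB : (1 + ε) * ((1 + ε) * F) + (2 + ε) * ρ ≤
        F + (4 * ε + 2 * ε ^ 2) * D + (2 + ε) * ρ := by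
      nlinarith [mul_nonneg hε0 (sub_nonneg.2 hF2), mul_nonneg (sq_nonneg ε) (sub_nonneg.2 hF2)]
    -- This puts every near-optimal center in the range of the packing bound.
    have hB6 : (1 + ε) * ((1 + ε) * F) + (2 + ε) * ρ ≤ 6 * D := by
      nlinarith [mul_nonneg hε0 hD.le, mul_nonneg (sub_nonneg.2 hε1) hD.le,
        mul_nonneg (mul_nonneg hε0 (sub_nonneg.2 hε1)) hD.le,
        mul_nonneg hε0 (sub_nonneg.2 hρD)]
    have hz6 : wdist G ℓ u z ≤ ENNReal.ofReal (6 * D) :=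
      (le_self_add.trans h).trans (ENNReal.ofReal_le_ofReal hB6)
    have hztop := ne_top_of_le_ne_top ENNReal.ofReal_ne_top hz6
    have hreal : (wdist G ℓ u z).toReal + (D - δ z) ≤
        (1 + ε) * ((1 + ε) * F) + (2 + ε) * ρ := by
      rw [← ENNReal.ofReal_toReal hztop] at h
      change _ + ENNReal.ofReal _ ≤ _ at h
      rw [← ENNReal.ofReal_add ENNReal.toReal_nonneg (by linarith [(hδ z hz).1.2])] at h
      exact (ENNReal.ofReal_le_ofReal_iff (by positivity)).1 h
    refine ⟨⟨hz, hz6⟩, fun k => ?_⟩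
    have hk := hFz k k.2.1 (ne_top_of_le_ne_top ENNReal.ofReal_ne_top k.2.2)
    -- Rounding enters once for `k` and once for `z`, hence `2 * η` in `margin`.
    have h1 := (abs_le.1 (hδ k k.2.1).2).1
    have h2 := (abs_le.1 (hδ z hz).2).2
    have key : (y k - (wdist G ℓ u k).toReal / D) * D ≤
        (y z - (wdist G ℓ u z).toReal / D + margin τ ε η) * D := by
      have e1 : (wdist G ℓ u k).toReal / D * D = (wdist G ℓ u k).toReal := by field_simp
      have e2 : (wdist G ℓ u z).toReal / D * D = (wdist G ℓ u z).toReal := by field_simp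
      have e3 : margin τ ε η * D =
          (4 * ε + 2 * ε ^ 2) * D + (2 + ε) * ρ + 2 * (η * D) := by
        rw [← hρm]; unfold margin; ring
      rw [sub_mul, add_mul, sub_mul, e1, e2, e3]
      linarith
    exact le_of_mul_le_mul_right key hD
  obtain ⟨x, hx, hux, p, hp, hlen, hpad⟩ := exists_cluster_path hε0 hT u
  rw [hF, ← ENNReal.ofReal_mul (by linarith)] at hlen hpad
  refine ⟨x, hx, hux, p, hp, ?_, fun v hv b hb => ?_⟩
  · have h : (walkLength ℓ p : ℝ) ≤ (1 + ε) * F := by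
      have := ENNReal.toReal_le_of_le_ofReal (by positivity) (le_self_add.trans hlen)
      simpa using this
    have h2 : (1 + ε) * F ≤ (1 + 1 / (40 * Real.log τ)) * (2 * D) := by gcongr
    linarith
  · obtain ⟨z, hz, hbz, hzle⟩ := hpad v hv b
    have hb' : wdist G ℓ v b ≤ ENNReal.ofReal ρ := hb
    by_cases hzx : z = x
    · exact hzx ▸ hbz
    exfalso
    obtain ⟨hz6, hzopt⟩ := hopt z hz (by
      have h1 : 1 + ENNReal.ofReal (1 + ε) = ENNReal.ofReal (2 + ε) := by
        rw [← ENNReal.ofReal_one, ← ENNReal.ofReal_add zero_le_one (by positivity)]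
        congr 1; ring
      rw [h1, ← ENNReal.ofReal_mul (by positivity)] at hzle
      refine hzle.trans ?_
      rw [ENNReal.ofReal_add (q := (2 + ε) * ρ) (by positivity) (by positivity),
        ENNReal.ofReal_mul (p := 2 + ε) (by positivity)]
      gcongr)
    obtain ⟨hx6, hxopt⟩ := hopt x hx (by
      refine le_trans ?_ (hlen.trans (ENNReal.ofReal_le_ofReal ?_))
      · exact add_le_add (wdist_le_walkLength p) le_rfl
      · have : 0 ≤ ε * ((1 + ε) * F) := by positivity
        have : 0 ≤ (2 + ε) * ρ := by positivity
        linarith)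
    exact hgood ⟨⟨z, hz6⟩, ⟨x, hx6⟩, fun h => hzx (congrArg Subtype.val h),
      fun k => ⟨hzopt k, hxopt k⟩⟩

end PseudoPadded

/-! ### Assembly. -/

theorem mainTheorem9 :
    ∃ c : ℝ, 1 ≤ c ∧ ∃ n₀ : ℕ,
      ∀ (V : Type*) [Fintype V] (G : SimpleGraph V) (ℓ : Sym2 V → ℝ≥0) (X : Set V)
        (D : ℝ) (τ : ℕ) (ε η : ℝ),
        0 < D → 2 ≤ τ →
        0 ≤ ε → ε ≤ 1 / (40 * Real.log τ) →
        -- either the offsets are not rounded, or they are rounded by at most `D / n ^ b`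
        -- for some `b ≥ 1` where `n` is the (large) number of nodes
        (η = 0 ∨ (n₀ ≤ Fintype.card V ∧ τ ≤ Fintype.card V ∧
          ∃ b : ℝ, 1 ≤ b ∧ η = 1 / (Fintype.card V : ℝ) ^ b)) →
        -- covering property
        (∀ v, ∃ x ∈ X, PseudoPadded.wdist G ℓ v x ≤ ENNReal.ofReal D) →
        -- packing property
        (∀ v, {x | x ∈ X ∧ PseudoPadded.wdist G ℓ v x ≤ ENNReal.ofReal (6 * D)}.ncard ≤ τ) →
        ∀ (Ω : Type*) [MeasurableSpace Ω] (P : MeasureTheory.Measure Ω)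
          [MeasureTheory.IsProbabilityMeasure P]
          (Y : V → Ω → ℝ) (δ : Ω → V → ℝ) (T : Ω → SimpleGraph (Option V)),
          PseudoPadded.IsRun G ℓ X D τ ε η P Y δ T →
          ∀ u : V, ∃ A : Set Ω, MeasurableSet A ∧ 1 / 2 ≤ P A ∧
            ∀ ω ∈ A, ∃ x ∈ X, u ∈ PseudoPadded.cluster (T ω) x ∧
              ∃ p : G.Walk u x, p.IsPath ∧
                (PseudoPadded.walkLength ℓ p : ℝ) ≤ 2 * (1 + 1 / (40 * Real.log τ)) * D ∧
                ∀ v ∈ p.support,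
                  PseudoPadded.wball G ℓ v (D / (c * Real.log τ)) ⊆
                    PseudoPadded.cluster (T ω) x := by
  refine ⟨1000, by norm_num, 10 ^ 9, ?_⟩
  intro V _ G ℓ X D τ ε η hD hτ hε0 hε hround hcov hpack Ω _ P _ Y δ T hrun u
  classical
  obtain ⟨hη0, hη⟩ : 0 ≤ η ∧ η * Real.log τ ≤ 1 / 2000 := by
    rcases hround with rfl | ⟨hn, hτn, b, hb, rfl⟩
    · norm_num
    · exact ⟨by positivity, PseudoPadded.rounding_le hn hτ hτn hb⟩
  let S : Set V := {x | x ∈ X ∧ PseudoPadded.wdist G ℓ u x ≤ ENNReal.ofReal (6 * D)}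
  let a : S → ℝ := fun i => (PseudoPadded.wdist G ℓ u i).toReal / D
  have hcard : Fintype.card S ≤ τ := by
    rw [← Nat.card_eq_fintype_card, Nat.card_coe_set_eq]
    exact hpack u
  have hind : ProbabilityTheory.iIndepFun (fun i : S => Y i) P :=
    hrun.indep.precomp (g := fun i : S => (⟨i, i.2.1⟩ : X))
      fun i j h => Subtype.ext (congrArg (fun x : X => (x : V)) h)
  have hbad := PseudoPadded.measure_margin_le_half hτ hε0 hε hη0 hη hcard hind
    (fun i => hrun.law i i.2.1) a
  set B : Set Ω := {ω | ∃ i j : S, i ≠ j ∧ ∀ k : S,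
    Y k ω - a k ≤ Y i ω - a i + PseudoPadded.margin τ ε η ∧
      Y k ω - a k ≤ Y j ω - a j + PseudoPadded.margin τ ε η}
  set N : Set Ω := {ω | ¬ ((∀ x ∈ X, δ ω x ∈ Set.Icc 0 D ∧ |δ ω x - D * Y x ω| ≤ η * D) ∧
    PseudoPadded.IsApproxSPTree (PseudoPadded.superGraph G X)
      (PseudoPadded.superLength ℓ fun x => (D - δ ω x).toNNReal) none ε (T ω))}
  have hN0 : P N = 0 := MeasureTheory.ae_iff.1 (hrun.offset.and hrun.tree)
  -- `T` and `δ` may depend on `ω` non-measurably, so the bad set is replaced by a measurable hull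
  -- of equal measure.
  refine ⟨(MeasureTheory.toMeasurable P (B ∪ N))ᶜ,
    (MeasureTheory.measurableSet_toMeasurable _ _).compl, ?_, fun ω hω => ?_⟩
  · rw [MeasureTheory.prob_compl_eq_one_sub (MeasureTheory.measurableSet_toMeasurable _ _),
      MeasureTheory.measure_toMeasurable]
    have h : P (B ∪ N) ≤ 1 / 2 :=
      (MeasureTheory.measure_union_le B N).trans (by rw [hN0, add_zero]; exact hbad)
    calc (1 / 2 : ℝ≥0∞) = 1 - 1 / 2 := by simp
      _ ≤ 1 - P (B ∪ N) := tsub_le_tsub_left h 1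
  · have hω' : ω ∉ B ∪ N := fun h => hω (MeasureTheory.subset_toMeasurable P _ h)
    have hωN := not_not.1 fun h => hω' (Or.inr h)
    exact PseudoPadded.exists_padded_path hD hτ hε0 hε hωN.1 hωN.2 (hcov u)
      fun h => hω' (Or.inl h)
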